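/- Let $\mathbb{D}=\{z\in\mathbb{C}:|z|<1\}$ and $k\in[0,1]$. Let $\mathcal{H}_k$ be the set of harmonic mappings $f=h+\overline{g}$ in $\mathbb{D}$, where $h(z)=\sum_{n=0}^{\infty}a_nz^n$ and $g(z)=\sum_{n=1}^{\infty}b_nz^n$ are analytic in $\mathbb{D}$ (so $g(0)=0$), $|h(z)|\le 1$ and $|g'(z)|\le k|h'(z)|$ for all $z\in\mathbb{D}$. Put $$c(0)=0,\qquad c(k)=\frac1k\ \ (0<k\le 1),\qquad r_1(x)=\begin{cases}\sqrt{\frac{1-x}{2}}, & 0\le x<\frac12,\\[1mm] \frac{1}{1+2x}, & \frac12\le x\le 1,\end{cases}$$ and, for $r\in[0,1)$, $$E_f(k,r)=\sum_{n=1}^{\infty}|a_n|r^n+\sum_{n=1}^{\infty}|b_n|r^n+\frac{1}{1+|a_0|}\cdot\frac{1+|a_0|r}{1-r}\left(\sum_{n=1}^{\infty}|a_n|^2r^{2n}+c(k)\sum_{n=1}^{\infty}|b_n|^2r^{2n}\right).$$ Let $f=h+\overline{g}\in\mathcal{H}_k$ with $h$ not identically constant, and let $q\ge 1$ be the order of the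 zero of $h-h(0)$ at $0$. 1. If $k\in(0,1]$, then $$E_f(k,r)\le(1-|a_0|^2)(1+k)\frac{r}{1-r}\qquad\text{for } 0\le r\le r_1\!\left(\frac{|b_q|}{k|a_q|}\right).$$ 2. If $k=0$, then the same inequality holds for all $r\in[0,1)$. 3. For every $k\in[0,1]$ and $a\in[0,1)$, let $h(z)=\omega_a(z)=\frac{z+a}{1+az}$ and $g=k(\omega_a-a)$. Then $f=h+\overline{g}\in\mathcal{H}_k$, $h$ is not constant, and equality holds in the above inequality for all $r\in[0,1)$. -/

import Mathlib

noncomputable section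

namespace BohrHarmonic

/-- The open unit disk of the complex plane. -/
def unitDisk : Set ℂ := Metric.ball (0 : ℂ) 1

/-- The `n`-th Taylor coefficient at the origin. -/
def coeff (F : ℂ → ℂ) (n : ℕ) : ℂ := iteratedDeriv n F 0 / (n.factorial : ℂ)

/-- `h` is analytic in the unit disk and bounded by one there. -/
structure InB (h : ℂ → ℂ) : Prop where
  analytic : DifferentiableOn ℂ h unitDisk
  bound : ∀ z ∈ unitDisk, ‖h z‖ ≤ 1

/-- `f = h + conj g` in the unit disk, with `h`, `g` analytic there and `g 0 = 0`. -/
structure InH (f h g : ℂ → ℂ) : Prop where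
  analytic_h : DifferentiableOn ℂ h unitDisk
  analytic_g : DifferentiableOn ℂ g unitDisk
  g_zero : g 0 = 0
  decomp : ∀ z ∈ unitDisk, f z = h z + (starRingEnd ℂ) (g z)

/-- `f = h + conj g` belongs to the class with `h` bounded by one and `|g'| ≤ k |h'|`. -/
structure InHk (k : ℝ) (f h g : ℂ → ℂ) : Prop extends InH f h g where
  h_mem : InB h
  deriv_le : ∀ z ∈ unitDisk, ‖deriv g z‖ ≤ k * ‖deriv h z‖

/-- `h` is not identically constant in the unit disk. -/
def Nonconstant (h : ℂ → ℂ) : Prop := ¬ ∃ c : ℂ, ∀ z ∈ unitDisk, h z = c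

/-- The function `h - h 0`. -/
def subAtZero (h : ℂ → ℂ) : ℂ → ℂ := fun z => h z - h 0

/-- The order of the zero of `h - h 0` at the origin (finite for the nonconstant analytic `h`). -/
def zeroOrder (h : ℂ → ℂ) : ℕ := analyticOrderNatAt (subAtZero h) 0

/-- `∑_{n ≥ 1} |c_n| r ^ n`, where the `c_n` are the Taylor coefficients of `F`. -/
def majorant (F : ℂ → ℂ) (r : ℝ) : ℝ := ∑' n : ℕ, ‖coeff F (n + 1)‖ * r ^ (n + 1)

/-- `‖F‖_r ^ 2 = ∑_{n ≥ 1} |c_n| ^ 2 r ^ (2 n)`. -/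
def normSq (F : ℂ → ℂ) (r : ℝ) : ℝ := ∑' n : ℕ, ‖coeff F (n + 1)‖ ^ 2 * r ^ (2 * (n + 1))

/-- The weight `c(k)`: zero for `k = 0`, and `1 / k` for `k ∈ (0, 1]`. -/
def weight (k : ℝ) : ℝ := if k = 0 then 0 else 1 / k

/-- The quantity `E_f(k, r)` of `f = h + conj g`. -/
def E (h g : ℂ → ℂ) (k r : ℝ) : ℝ :=
  majorant h r + majorant g r
    + 1 / (1 + ‖coeff h 0‖) * ((1 + ‖coeff h 0‖ * r) / (1 - r))
      * (normSq (subAtZero h) r + weight k * normSq g r)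

/-- The radius `r₁(x)`, for `x ∈ [0, 1]`. -/
def radius (x : ℝ) : ℝ := if x < 1 / 2 then Real.sqrt ((1 - x) / 2) else 1 / (1 + 2 * x)

/-- The disk automorphism `ω_a(z) = (z + a) / (1 + a z)`. -/
def omega (a : ℝ) : ℂ → ℂ := fun z => (z + (a : ℂ)) / (1 + (a : ℂ) * z)

end BohrHarmonic

end

namespace BohrHarmonic

open Metric Filter Topology
open scoped ComplexConjugate

/-! The theorem splits into a sharp inequality for `h` alone and a comparison of `g` with `h`.

Write M for `majorant`, N for `normSq` and C for the factor in front of the quadratic terms.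
Multiplication by `h` does not increase the sum of the squared coefficients of a polynomial.
Suitable test polynomials then give Carlson's bounds for `coeff h (2n+1)` and `coeff h (2n+2)` in
terms of earlier coefficients. Summed against powers of r, these yield exactly M(h) + C N(h) ≤ (1 -
|a₀|²) r/(1 - r), for every r < 1 (`majorant_add_normSq_le`).

For k > 0 the quotient w = g'/(k h') extends analytically with |w| ≤ 1, and comparing lowest-order
terms gives |w(0)| = |b_q|/(k|a_q|). Multiplying the series of w and h' gives M(g) ≤ k M(h) (|w(0)|
+ M(w)), where the last factor is at most 1 up to the Bohr radius r₁(|w(0)|)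
(`majorant_le_of_le_radius`). Parseval and two integrations in r² give N(g) ≤ k² N(h), so the weight
1/k leaves k N(h). Hence E is at most 1 + k times the left side of the inequality for `h`. For k =
0, g vanishes. For `omega a` every series is geometric. -/

/-! ### Taylor coefficients on the unit disk -/

lemma mem_unitDisk {z : ℂ} : z ∈ unitDisk ↔ ‖z‖ < 1 := by
  simp [unitDisk]

lemma isOpen_unitDisk : IsOpen unitDisk := isOpen_ball

lemma hasSum_coeff {F : ℂ → ℂ} (hF : DifferentiableOn ℂ F unitDisk) {z : ℂ} (hz : ‖z‖ < 1) :
    HasSum (fun n => coeff F n * z ^ n) (F z) := by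
  have := Complex.hasSum_taylorSeries_on_ball (f := F) (c := 0) (r := 1) (z := z)
    (by simpa [unitDisk] using hF) (by simpa using hz)
  refine this.congr_fun ?_
  intro n
  simp [coeff, div_eq_mul_inv]
  ring

lemma coeff_eq_of_hasSum {F : ℂ → ℂ} {c : ℕ → ℂ}
    (hc : ∀ z : ℂ, ‖z‖ < 1 → HasSum (fun n => c n * z ^ n) (F z)) (n : ℕ) : coeff F n = c n := by
  have h1 : HasFPowerSeriesOnBall F (FormalMultilinearSeries.ofScalars ℂ c) 0 1 := by
    refine ⟨?_, one_pos, ?_⟩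
    · refine le_of_forall_lt_imp_le_of_dense fun r hr => ?_
      lift r to NNReal using ne_top_of_lt hr
      refine FormalMultilinearSeries.le_radius_of_tendsto _ (l := 0) ?_
      have := (hc (r : ℂ) (by simpa using hr)).summable.tendsto_atTop_zero.norm
      simpa using this
    · intro y hy
      have hy' : ‖y‖ < 1 := by simpa [enorm, ← NNReal.coe_lt_coe] using hy
      simpa [FormalMultilinearSeries.ofScalars_apply_eq, mul_comm] using hc y hy'
  have h2 := h1.factorial_smul 1 n
  rw [coeff, iteratedDeriv_eq_iteratedFDeriv, ← h2]
  have : (n.factorial : ℂ) ≠ 0 := by exact_mod_cast n.factorial_ne_zero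
  simp [this]

lemma summable_norm_coeff {F : ℂ → ℂ} (hF : DifferentiableOn ℂ F unitDisk) {r : ℝ}
    (h0 : 0 ≤ r) (h1 : r < 1) : Summable (fun n => ‖coeff F n‖ * r ^ n) := by
  have := (hasSum_coeff hF (z := r) (by simpa [abs_of_nonneg h0])).summable.norm
  simpa [abs_of_nonneg h0] using this

lemma coeff_zero (F : ℂ → ℂ) : coeff F 0 = F 0 := by simp [coeff]

lemma coeff_deriv (F : ℂ → ℂ) (n : ℕ) : coeff (deriv F) n = (n + 1) * coeff F (n + 1) := by
  have : (n.factorial : ℂ) ≠ 0 := by exact_mod_cast n.factorial_ne_zero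
  have : (n + 1 : ℂ) ≠ 0 := by exact_mod_cast n.succ_ne_zero
  rw [coeff, coeff, iteratedDeriv_succ', Nat.factorial_succ]
  push_cast
  field_simp

lemma coeff_mul {F G : ℂ → ℂ} (hF : DifferentiableOn ℂ F unitDisk)
    (hG : DifferentiableOn ℂ G unitDisk) (n : ℕ) :
    coeff (fun z => F z * G z) n
      = ∑ p ∈ Finset.HasAntidiagonal.antidiagonal n, coeff F p.1 * coeff G p.2 := by
  refine coeff_eq_of_hasSum (c := fun n =>
    ∑ p ∈ Finset.HasAntidiagonal.antidiagonal n, coeff F p.1 * coeff G p.2) (fun z hz => ?_) n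
  have hf := hasSum_coeff hF hz
  have hg := hasSum_coeff hG hz
  have hs := (summable_norm_sum_mul_antidiagonal_of_summable_norm hf.summable.norm
    hg.summable.norm).of_norm.hasSum
  rw [← tsum_mul_tsum_eq_tsum_sum_antidiagonal_of_summable_norm hf.summable.norm
    hg.summable.norm, hf.tsum_eq, hg.tsum_eq] at hs
  refine hs.congr_fun fun n => ?_
  rw [Finset.sum_mul]
  refine Finset.sum_congr rfl fun p hp => ?_
  rw [← Finset.HasAntidiagonal.mem_antidiagonal.1 hp, pow_add]
  ring

lemma coeff_subAtZero_succ {F : ℂ → ℂ} (n : ℕ) : coeff (subAtZero F) (n + 1) = coeff F (n + 1) := by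
  have : deriv (subAtZero F) = deriv F := by
    ext z; exact deriv_sub_const _
  simp [coeff, iteratedDeriv_succ', this]

lemma coeff_subAtZero_zero {F : ℂ → ℂ} : coeff (subAtZero F) 0 = 0 := by
  simp [coeff_zero, subAtZero]

/-! ### Parseval's identity on circles -/

section Parseval

open AddCircle MeasureTheory

/-- The restriction of `F` to the circle of radius `r`, as a continuous function on `ℝ / ℤ`. -/
noncomputable def circleRestrict {F : ℂ → ℂ} (hF : DifferentiableOn ℂ F unitDisk) {r : ℝ}
    (h0 : 0 ≤ r) (h1 : r < 1) : C(AddCircle (1 : ℝ), ℂ) where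
  toFun x := F (r * (toCircle x : ℂ))
  continuous_toFun := by
    refine hF.continuousOn.comp_continuous ?_ fun x => ?_
    · exact continuous_const.mul (continuous_subtype_val.comp continuous_toCircle)
    · simpa [mem_unitDisk, abs_of_nonneg h0, Circle.norm_coe] using h1

lemma hasSum_circleRestrict {F : ℂ → ℂ} (hF : DifferentiableOn ℂ F unitDisk) {r : ℝ}
    (h0 : 0 ≤ r) (h1 : r < 1) :
    HasSum (fun n : ℕ => (coeff F n * r ^ n) • fourier (T := (1 : ℝ)) (n : ℤ))
      (circleRestrict hF h0 h1) := by
  have hs : Summable (fun n : ℕ => (coeff F n * r ^ n) • fourier (T := (1 : ℝ)) (n : ℤ)) := by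
    refine Summable.of_norm ?_
    simpa [norm_smul, fourier_norm, abs_of_nonneg h0] using summable_norm_coeff hF h0 h1
  convert hs.hasSum
  ext x
  have hx := ContinuousMap.hasSum_apply hs.hasSum x
  refine HasSum.unique ?_ hx
  have := hasSum_coeff hF (z := r * (toCircle x : ℂ)) (by simpa [abs_of_nonneg h0, Circle.norm_coe] using h1)
  refine this.congr_fun fun n => ?_
  simp [mul_pow, mul_assoc, toCircle_nsmul]

/-- On the circle of radius r the Taylor series is a Fourier series with nonnegative frequencies
only. Orthonormality identifies its coefficients, and pairing the expansion with the function itself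
gives the squared L² norm. -/
lemma hasSum_normSq_coeff {F : ℂ → ℂ} (hF : DifferentiableOn ℂ F unitDisk) {r : ℝ}
    (h0 : 0 ≤ r) (h1 : r < 1) :
    HasSum (fun n => ‖coeff F n‖ ^ 2 * (r ^ 2) ^ n)
      (‖ContinuousMap.toLp (E := ℂ) 2 haarAddCircle ℂ (circleRestrict hF h0 h1)‖ ^ 2) := by
  set x := ContinuousMap.toLp (E := ℂ) 2 haarAddCircle ℂ (circleRestrict hF h0 h1) with hx
  have hs : HasSum (fun n : ℕ => (coeff F n * r ^ n) • fourierLp (T := (1 : ℝ)) 2 (n : ℤ)) x := by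
    have := (hasSum_circleRestrict hF h0 h1).mapL
      (ContinuousMap.toLp (E := ℂ) 2 (haarAddCircle (T := 1)) ℂ)
    simpa [fourierLp] using this
  have horth := orthonormal_iff_ite.1 (orthonormal_fourier (T := (1 : ℝ)))
  have hin (m : ℕ) : inner ℂ (fourierLp (T := (1 : ℝ)) 2 (m : ℤ)) x = coeff F m * r ^ m := by
    have h2 := hs.mapL (innerSL ℂ (fourierLp (T := (1 : ℝ)) 2 (m : ℤ)))
    simp only [innerSL_apply_apply, inner_smul_right, horth, Nat.cast_inj] at h2
    refine h2.unique ?_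
    refine (hasSum_ite_eq m (coeff F m * (r : ℂ) ^ m)).congr_fun fun n => ?_
    by_cases h : m = n
    · simp [h]
    · simp [h, Ne.symm h]
  have h3 := hs.mapL (innerSL ℂ x)
  simp only [innerSL_apply_apply, inner_smul_right] at h3
  have h4 := Complex.reCLM.hasSum h3
  rw [inner_self_eq_norm_sq_to_K] at h4
  have h5 : Complex.reCLM (((‖x‖ : ℝ) : ℂ) ^ 2) = ‖x‖ ^ 2 := by
    rw [Complex.reCLM_apply, ← Complex.ofReal_pow, Complex.ofReal_re]
  erw [h5] at h4
  refine h4.congr_fun fun n => ?_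
  have : inner ℂ x (fourierLp (T := (1 : ℝ)) 2 (n : ℤ)) = conj (coeff F n * r ^ n) := by
    rw [← hin, inner_conj_symm]
  simp only [this, Complex.mul_conj, Complex.reCLM_apply, Complex.ofReal_re]
  rw [Complex.normSq_eq_norm_sq]
  rw [norm_mul, norm_pow, Complex.norm_real, Real.norm_of_nonneg h0]
  ring

lemma tsum_normSq_coeff_le {F G : ℂ → ℂ} (hF : DifferentiableOn ℂ F unitDisk)
    (hG : DifferentiableOn ℂ G unitDisk) {r : ℝ} (h0 : 0 ≤ r) (h1 : r < 1)
    (hFG : ∀ z : ℂ, ‖z‖ = r → ‖F z‖ ≤ ‖G z‖) :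
    ∑' n, ‖coeff F n‖ ^ 2 * (r ^ 2) ^ n ≤ ∑' n, ‖coeff G n‖ ^ 2 * (r ^ 2) ^ n := by
  rw [(hasSum_normSq_coeff hF h0 h1).tsum_eq, (hasSum_normSq_coeff hG h0 h1).tsum_eq]
  gcongr
  refine Lp.norm_le_norm_of_ae_le ?_
  filter_upwards [ContinuousMap.coeFn_toLp (p := 2) (𝕜 := ℂ) haarAddCircle (circleRestrict hF h0 h1),
    ContinuousMap.coeFn_toLp (p := 2) (𝕜 := ℂ) haarAddCircle (circleRestrict hG h0 h1)] with x h2 h3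
  rw [h2, h3]
  exact hFG _ (by simp [abs_of_nonneg h0, Circle.norm_coe])

lemma summable_normSq_coeff {F : ℂ → ℂ} (hF : DifferentiableOn ℂ F unitDisk) {x : ℝ}
    (h0 : 0 ≤ x) (h1 : x < 1) : Summable (fun n => ‖coeff F n‖ ^ 2 * x ^ n) := by
  have := (hasSum_normSq_coeff hF (Real.sqrt_nonneg x)
    ((Real.sqrt_lt' one_pos).2 (by simpa using h1))).summable
  simpa [Real.sq_sqrt h0] using this

end Parseval

/-! ### Carlson's coefficient inequalities -/

lemma coeff_mul_eq_powerSeries {F G : ℂ → ℂ} (hF : DifferentiableOn ℂ F unitDisk)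
    (hG : DifferentiableOn ℂ G unitDisk) (n : ℕ) :
    coeff (fun z => F z * G z) n
      = PowerSeries.coeff n (PowerSeries.mk (coeff F) * PowerSeries.mk (coeff G)) := by
  simp [coeff_mul hF hG, PowerSeries.coeff_mul]

lemma coeff_polynomial (p : Polynomial ℂ) (n : ℕ) : coeff (fun z => p.eval z) n = p.coeff n := by
  refine coeff_eq_of_hasSum (c := p.coeff) (fun z _ => ?_) n
  rw [Polynomial.eval_eq_sum_range]
  refine hasSum_sum_of_ne_finset_zero fun m hm => ?_
  rw [Polynomial.coeff_eq_zero_of_natDegree_lt (by simpa using hm), zero_mul]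

/-- Since |hp| ≤ |p| on each circle of radius r < 1, Parseval compares the weighted sums. Truncating
the left side to N terms makes the passage r → 1 a limit of a finite sum. -/
lemma sum_norm_sq_coeff_mul_polynomial_le {h : ℂ → ℂ} (hh : InB h) (p : Polynomial ℂ) (N : ℕ) :
    ∑ m ∈ Finset.range N, ‖coeff (fun z => h z * p.eval z) m‖ ^ 2
      ≤ ∑ m ∈ Finset.range (p.natDegree + 1), ‖p.coeff m‖ ^ 2 := by
  have hp : DifferentiableOn ℂ (fun z => p.eval z) unitDisk := p.differentiable.differentiableOn
  have hhp := hh.analytic.fun_mul hp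
  have key (r : ℝ) (hr : r ∈ Set.Ioo (0 : ℝ) 1) :
      ∑ m ∈ Finset.range N, ‖coeff (fun z => h z * p.eval z) m‖ ^ 2 * (r ^ 2) ^ m
        ≤ ∑ m ∈ Finset.range (p.natDegree + 1), ‖p.coeff m‖ ^ 2 := by
    have h1 : r ^ 2 < 1 := by nlinarith [hr.1, hr.2]
    refine ((summable_normSq_coeff hhp (sq_nonneg r) h1).sum_le_tsum _
      fun m _ => by positivity).trans ?_
    refine (tsum_normSq_coeff_le hhp hp hr.1.le hr.2 fun z hz => ?_).trans ?_
    · rw [norm_mul]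
      exact mul_le_of_le_one_left (norm_nonneg _) (hh.bound z (mem_unitDisk.2 (hz ▸ hr.2)))
    · rw [tsum_eq_sum (s := Finset.range (p.natDegree + 1))]
      · refine Finset.sum_le_sum fun m _ => ?_
        rw [coeff_polynomial]
        exact mul_le_of_le_one_right (by positivity) (pow_le_one₀ (sq_nonneg r) h1.le)
      · intro m hm
        rw [coeff_polynomial, Polynomial.coeff_eq_zero_of_natDegree_lt (by simpa using hm)]
        simp
  have hlim : Tendsto (fun r : ℝ => ∑ m ∈ Finset.range N,
      ‖coeff (fun z => h z * p.eval z) m‖ ^ 2 * (r ^ 2) ^ m) (𝓝[<] 1)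
      (𝓝 (∑ m ∈ Finset.range N, ‖coeff (fun z => h z * p.eval z) m‖ ^ 2 * ((1 : ℝ) ^ 2) ^ m)) :=
    Tendsto.mono_left (Continuous.tendsto (by fun_prop) 1) nhdsWithin_le_nhds
  simp only [one_pow, mul_one] at hlim
  refine le_of_tendsto hlim ?_
  filter_upwards [Ioo_mem_nhdsLT (zero_lt_one (α := ℝ))] with r hr using key r hr

/-- The bound `∑ |(hp)_m|² ≤ ∑ |p_m|²` for `p = 1 + z ^ n ∑_{i < L} c_i z ^ i`. -/
lemma sum_norm_sq_coeff_add_le {h : ℂ → ℂ} (hh : InB h) {n : ℕ} (hn : 0 < n) (L : ℕ) (c : ℕ → ℂ) :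
    ∑ m ∈ Finset.range n, ‖coeff h m‖ ^ 2 + ∑ l ∈ Finset.range L,
        ‖coeff h (n + l) + ∑ i ∈ Finset.range (l + 1), c i * coeff h (l - i)‖ ^ 2
      ≤ 1 + ∑ i ∈ Finset.range L, ‖c i‖ ^ 2 := by
  set C : Polynomial ℂ := ∑ i ∈ Finset.range L, Polynomial.monomial i (c i) with hC
  have hCc (i : ℕ) : C.coeff i = if i < L then c i else 0 := by
    simp [hC, Polynomial.finsetSum_coeff, Polynomial.coeff_monomial]
  set p : Polynomial ℂ := 1 + Polynomial.X ^ n * C with hp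
  have hpd : DifferentiableOn ℂ (fun z => p.eval z) unitDisk := p.differentiable.differentiableOn
  have hmk : PowerSeries.mk (coeff fun z => p.eval z) = (p : PowerSeries ℂ) := by
    ext m; simp [coeff_polynomial]
  have hprod : PowerSeries.mk (coeff h) * (p : PowerSeries ℂ)
      = PowerSeries.mk (coeff h)
        + PowerSeries.X ^ n * (PowerSeries.mk (coeff h) * (C : PowerSeries ℂ)) := by
    rw [hp]; push_cast; ring
  have hlow (m : ℕ) (hm : m < n) : coeff (fun z => h z * p.eval z) m = coeff h m := by
    rw [coeff_mul_eq_powerSeries hh.analytic hpd, hmk, hprod, map_add,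
      PowerSeries.coeff_X_pow_mul', if_neg (by omega)]
    simp
  have hhigh (l : ℕ) (hl : l < L) : coeff (fun z => h z * p.eval z) (n + l)
      = coeff h (n + l) + ∑ i ∈ Finset.range (l + 1), c i * coeff h (l - i) := by
    rw [coeff_mul_eq_powerSeries hh.analytic hpd, hmk, hprod, map_add,
      PowerSeries.coeff_X_pow_mul', if_pos (by omega), mul_comm, PowerSeries.coeff_mul,
      Finset.Nat.sum_antidiagonal_eq_sum_range_succ_mk]
    simp only [PowerSeries.coeff_mk, Polynomial.coeff_coe, Nat.add_sub_cancel_left]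
    congr 1
    refine Finset.sum_congr rfl fun i hi => ?_
    rw [hCc, if_pos (by have := Finset.mem_range.1 hi; omega)]
  have hmain := sum_norm_sq_coeff_mul_polynomial_le hh p (n + L)
  rw [Finset.sum_range_add] at hmain
  have hl1 : ∑ m ∈ Finset.range n, ‖coeff (fun z => h z * p.eval z) m‖ ^ 2
      = ∑ m ∈ Finset.range n, ‖coeff h m‖ ^ 2 :=
    Finset.sum_congr rfl fun m hm => by rw [hlow m (Finset.mem_range.1 hm)]
  have hl2 : ∑ l ∈ Finset.range L, ‖coeff (fun z => h z * p.eval z) (n + l)‖ ^ 2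
      = ∑ l ∈ Finset.range L,
        ‖coeff h (n + l) + ∑ i ∈ Finset.range (l + 1), c i * coeff h (l - i)‖ ^ 2 :=
    Finset.sum_congr rfl fun l hl => by rw [hhigh l (Finset.mem_range.1 hl)]
  rw [hl1, hl2] at hmain
  refine hmain.trans (le_of_eq ?_)
  -- The last c_i may vanish, so the exact degree is unknown; the two ranges differ only by zero
  -- coefficients.
  have hdeg : ∑ m ∈ Finset.range (p.natDegree + 1), ‖p.coeff m‖ ^ 2
      = ∑ m ∈ Finset.range (n + L), ‖p.coeff m‖ ^ 2 := by
    have hz (m : ℕ) (hm : n + L ≤ m) : p.coeff m = 0 := by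
      rw [hp, Polynomial.coeff_add, Polynomial.coeff_X_pow_mul', if_pos (by omega), hCc,
        if_neg (by omega), Polynomial.coeff_one, if_neg (by omega), add_zero]
    rcases le_total (p.natDegree + 1) (n + L) with hle | hle
    · refine Finset.sum_subset (Finset.range_subset_range.2 hle) fun m _ hm => ?_
      rw [Polynomial.coeff_eq_zero_of_natDegree_lt (by simpa using hm)]; simp
    · refine (Finset.sum_subset (Finset.range_subset_range.2 hle) fun m _ hm => ?_).symm
      rw [hz m (by simpa using hm)]; simp
  rw [hdeg, Finset.sum_range_add]
  congr 1
  · rw [Finset.sum_eq_single 0]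
    · rw [hp, Polynomial.coeff_add, Polynomial.coeff_X_pow_mul', if_neg (by omega)]; simp
    · intro m hm h0
      rw [hp, Polynomial.coeff_add, Polynomial.coeff_X_pow_mul',
        if_neg (by have := Finset.mem_range.1 hm; omega), Polynomial.coeff_one, if_neg h0]
      simp
    · intro h; exact absurd (Finset.mem_range.2 hn) h
  · refine Finset.sum_congr rfl fun i hi => ?_
    rw [hp, Polynomial.coeff_add, Polynomial.coeff_X_pow_mul', if_pos (by omega), hCc,
      Nat.add_sub_cancel_left, if_pos (Finset.mem_range.1 hi), Polynomial.coeff_one,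
      if_neg (by omega), zero_add]

lemma norm_le_one_sub_of_forall {S : ℝ} (hS : 0 ≤ S) {b : ℂ}
    (hb : ∀ t : ℂ, S + ‖b + t * S‖ ^ 2 ≤ 1 + ‖t‖ ^ 2 * S) : ‖b‖ ≤ 1 - S := by
  have h1 : S ≤ 1 := by
    have := hb 0
    simp at this
    nlinarith [sq_nonneg ‖b‖]
  rcases h1.eq_or_lt with rfl | h1
  · have := hb b
    have h2 : ‖b + b * ((1 : ℝ) : ℂ)‖ = 2 * ‖b‖ := by
      rw [Complex.ofReal_one, mul_one, ← two_mul, norm_mul]; simp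
    rw [h2] at this
    nlinarith [norm_nonneg b]
  · have hD : 0 < 1 - S := by linarith
    have hD' : ((1 - S : ℝ) : ℂ) ≠ 0 := by exact_mod_cast hD.ne'
    -- This t is the fixed point of t ↦ b + tS, so the hypothesis becomes |t|²(1 - S) ≤ 1 - S, that
    -- is |t| ≤ 1.
    have := hb (b / ((1 - S : ℝ) : ℂ))
    have h2 : b + b / ((1 - S : ℝ) : ℂ) * S = b / ((1 - S : ℝ) : ℂ) := by
      field_simp
      push_cast
      ring
    rw [h2, norm_div, Complex.norm_real, Real.norm_of_nonneg hD.le] at this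
    have h3 : (‖b‖ / (1 - S)) ^ 2 * (1 - S) ≤ 1 * (1 - S) := by nlinarith
    have h4 := le_of_mul_le_mul_right h3 hD
    have h5 := (sq_le_one_iff₀ (by positivity)).1 h4
    exact (div_le_one hD).1 h5

lemma sum_mul_conj_reflect (a : ℕ → ℂ) (t : ℂ) (n : ℕ) :
    ∑ i ∈ Finset.range n, t * conj (a (n - 1 - i)) * a (n - 1 - i)
      = t * ((∑ j ∈ Finset.range n, ‖a j‖ ^ 2 : ℝ) : ℂ) := by
  rw [← Finset.sum_range_reflect (fun j => ‖a j‖ ^ 2), Complex.ofReal_sum, Finset.mul_sum]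
  refine Finset.sum_congr rfl fun i _ => ?_
  rw [mul_assoc, mul_comm (conj _), Complex.mul_conj, Complex.normSq_eq_norm_sq]

lemma sum_norm_sq_mul_conj_reflect (a : ℕ → ℂ) (t : ℂ) (n : ℕ) :
    ∑ i ∈ Finset.range n, ‖t * conj (a (n - 1 - i))‖ ^ 2
      = ‖t‖ ^ 2 * ∑ j ∈ Finset.range n, ‖a j‖ ^ 2 := by
  rw [← Finset.sum_range_reflect (fun j => ‖a j‖ ^ 2), Finset.mul_sum]
  refine Finset.sum_congr rfl fun i _ => ?_
  rw [norm_mul, RCLike.norm_conj, mul_pow]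

/-- **Carlson's inequality** for the coefficients of odd index. -/
lemma norm_coeff_odd_le {h : ℂ → ℂ} (hh : InB h) (n : ℕ) :
    ‖coeff h (2 * n + 1)‖ ≤ 1 - ∑ j ∈ Finset.range (n + 1), ‖coeff h j‖ ^ 2 := by
  refine norm_le_one_sub_of_forall (Finset.sum_nonneg fun j _ => by positivity) fun t => ?_
  -- With c_i = t · conj a_{n-i}, the coefficient of index 2n+1 in the product is a_{2n+1} + tS,
  -- where S is the sum of |a_j|² over j ≤ n. Only this term of the second sum is kept.
  have := sum_norm_sq_coeff_add_le hh n.succ_pos (n + 1)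
    (fun i => t * conj (coeff h (n + 1 - 1 - i)))
  rw [sum_norm_sq_mul_conj_reflect] at this
  refine le_trans ?_ this
  gcongr
  refine le_trans (le_of_eq ?_) (Finset.single_le_sum (fun l _ => by positivity)
    (Finset.self_mem_range_succ n))
  rw [← sum_mul_conj_reflect]
  congr 4
  rw [Nat.succ_eq_add_one]
  ring

/-- The phase of s aligns sw with z, so that the triangle inequality becomes an equality in the
even-index Carlson bound. -/
lemma exists_phase (z w : ℂ) (c : ℝ) (hc : 0 ≤ c) :
    ∃ s : ℂ, ‖s‖ = c * ‖w‖ ∧ ‖z + s * w‖ = ‖z‖ + c * ‖w‖ ^ 2 := by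
  obtain ⟨u, hu, hz⟩ : ∃ u : ℂ, ‖u‖ = 1 ∧ z = ‖z‖ * u := by
    rcases eq_or_ne z 0 with rfl | h
    · exact ⟨1, by simp⟩
    · have : (‖z‖ : ℂ) ≠ 0 := by exact_mod_cast norm_ne_zero_iff.2 h
      refine ⟨z / ‖z‖, ?_, by field_simp⟩
      rw [norm_div, Complex.norm_real, norm_norm, div_self (norm_ne_zero_iff.2 h)]
  refine ⟨c * u * conj w, ?_, ?_⟩
  · simp [hu, abs_of_nonneg hc]
  · have : z + c * u * conj w * w = ((‖z‖ + c * ‖w‖ ^ 2 : ℝ) : ℂ) * u := by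
      rw [mul_assoc _ (conj w), mul_comm (conj w), Complex.mul_conj, Complex.normSq_eq_norm_sq]
      nth_rewrite 1 [hz]
      push_cast
      ring
    rw [this, norm_mul, hu, mul_one, Complex.norm_real, Real.norm_of_nonneg (by positivity)]

/-- **Carlson's inequality** for the coefficients of even index. -/
lemma norm_coeff_even_le {h : ℂ → ℂ} (hh : InB h) (n : ℕ) :
    ‖coeff h (2 * n + 2)‖ ≤ 1 - ∑ j ∈ Finset.range (n + 1), ‖coeff h j‖ ^ 2
      - ‖coeff h (n + 1)‖ ^ 2 / (1 + ‖coeff h 0‖) := by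
  have hα := norm_nonneg (coeff h 0)
  set α := ‖coeff h 0‖ with hαdef
  set S := ∑ j ∈ Finset.range (n + 1), ‖coeff h j‖ ^ 2 with hS
  obtain ⟨s, hs, hb⟩ := exists_phase (coeff h (2 * n + 2)) (coeff h (n + 1)) (1 / (1 + α))
    (by positivity)
  -- The size |s| = |a_{n+1}|/(1 + |a₀|) is chosen so that |a_{n+1}| - |s||a₀| = |s|. The middle
  -- coefficient then pays for the cost |s|² of adding s to the test polynomial.
  have hmid : ‖s‖ ^ 2 ≤ ‖coeff h (n + 1) + s * coeff h 0‖ ^ 2 := by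
    refine pow_le_pow_left₀ (norm_nonneg _) ?_ 2
    have h1 := norm_sub_le (coeff h (n + 1) + s * coeff h 0) (s * coeff h 0)
    rw [add_sub_cancel_right, norm_mul, ← hαdef] at h1
    have h2 : ‖coeff h (n + 1)‖ = ‖s‖ * (1 + α) := by rw [hs]; field_simp
    linarith
  have hmain : ‖coeff h (2 * n + 2) + s * coeff h (n + 1)‖ ≤ 1 - S := by
    refine norm_le_one_sub_of_forall (Finset.sum_nonneg fun j _ => by positivity) fun t => ?_
    -- The odd-index choice is shifted by one place, with s put in front; the coefficient of index
    -- 2n+2 becomes a_{2n+2} + s a_{n+1} + tS.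
    obtain ⟨c, hc0, hc⟩ : ∃ c : ℕ → ℂ, c 0 = s ∧
        ∀ i, c (i + 1) = t * conj (coeff h (n + 1 - 1 - i)) :=
      ⟨fun i => Nat.casesOn i s fun i => t * conj (coeff h (n + 1 - 1 - i)), rfl, fun _ => rfl⟩
    have := sum_norm_sq_coeff_add_le hh (Nat.add_one_pos n) (n + 1 + 1) c
    rw [Finset.sum_range_succ' (fun i => ‖c i‖ ^ 2) (n + 1),
      Finset.sum_range_succ' (fun l => ‖coeff h (n + 1 + l) + _‖ ^ 2) (n + 1)] at this
    simp only [hc, hc0] at this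
    rw [sum_norm_sq_mul_conj_reflect] at this
    have h3 := Finset.single_le_sum (f := fun l => ‖coeff h (n + 1 + (l + 1)) +
      ∑ i ∈ Finset.range (l + 1 + 1), c i * coeff h (l + 1 - i)‖ ^ 2)
      (fun l _ => by positivity) (Finset.self_mem_range_succ n)
    rw [Finset.sum_range_succ' (fun i => c i * coeff h (n + 1 - i)) (n + 1)] at h3
    have h4 := sum_mul_conj_reflect (coeff h) t (n + 1)
    rw [← hS] at h4
    simp only [hc, hc0, Nat.add_sub_add_right, Nat.add_sub_cancel, Nat.sub_zero] at h3 h4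
    rw [h4] at h3
    have h5 : coeff h (2 * n + 2) + s * coeff h (n + 1) + t * S
      = coeff h (n + 1 + (n + 1)) + (t * S + s * coeff h (n + 1)) := by
      rw [show 2 * n + 2 = n + 1 + (n + 1) by ring]; ring
    rw [h5]
    simp only [zero_add, Finset.sum_range_one, hc0, add_zero, Nat.sub_zero] at this
    linarith
  rw [hb] at hmain
  have : 1 / (1 + α) * ‖coeff h (n + 1)‖ ^ 2 = ‖coeff h (n + 1)‖ ^ 2 / (1 + α) := by ring
  linarith

/-! ### The sharp inequality for the analytic part -/

lemma hasSum_majorant {F : ℂ → ℂ} (hF : DifferentiableOn ℂ F unitDisk) {r : ℝ}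
    (h0 : 0 ≤ r) (h1 : r < 1) :
    HasSum (fun n : ℕ => ‖coeff F (n + 1)‖ * r ^ (n + 1)) (majorant F r) :=
  ((summable_nat_add_iff 1).2 (summable_norm_coeff hF h0 h1)).hasSum

lemma hasSum_normSq {F : ℂ → ℂ} (hF : DifferentiableOn ℂ F unitDisk) {r : ℝ}
    (h0 : 0 ≤ r) (h1 : r < 1) :
    HasSum (fun n : ℕ => ‖coeff F (n + 1)‖ ^ 2 * r ^ (2 * (n + 1))) (normSq F r) := by
  have := (summable_nat_add_iff 1).2
    (summable_normSq_coeff hF (sq_nonneg r) (show r ^ 2 < 1 by nlinarith))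
  simp only [← pow_mul] at this
  exact this.hasSum

lemma normSq_subAtZero (F : ℂ → ℂ) (r : ℝ) : normSq (subAtZero F) r = normSq F r := by
  simp [normSq, coeff_subAtZero_succ]

lemma hasSum_normSq_add {F : ℂ → ℂ} (hF : DifferentiableOn ℂ F unitDisk) {r : ℝ}
    (h0 : 0 ≤ r) (h1 : r < 1) :
    HasSum (fun n : ℕ => ‖coeff F n‖ ^ 2 * (r ^ 2) ^ n) (normSq F r + ‖coeff F 0‖ ^ 2) := by
  rw [← hasSum_nat_add_iff' 1]
  simpa [← pow_mul] using hasSum_normSq hF h0 h1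

lemma hasSum_partialSum_mul_pow {u : ℕ → ℝ} {x U : ℝ} (h0 : 0 ≤ x) (h1 : x < 1)
    (hU : HasSum (fun n => u n * x ^ n) U) :
    HasSum (fun n => (∑ j ∈ Finset.range (n + 1), u j) * x ^ n) (U * (1 - x)⁻¹) := by
  have hg := hasSum_geometric_of_lt_one h0 h1
  have hs1 : Summable fun n => ‖u n * x ^ n‖ := hU.summable.norm
  have hs2 : Summable fun n => ‖x ^ n‖ := hg.summable.norm
  have := (summable_norm_sum_mul_antidiagonal_of_summable_norm hs1 hs2).of_norm.hasSum
  rw [← tsum_mul_tsum_eq_tsum_sum_antidiagonal_of_summable_norm hs1 hs2, hU.tsum_eq,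
    hg.tsum_eq] at this
  refine this.congr_fun fun n => ?_
  rw [Finset.Nat.sum_antidiagonal_eq_sum_range_succ_mk, Finset.sum_mul]
  refine Finset.sum_congr rfl fun j hj => ?_
  have : x ^ n = x ^ j * x ^ (n - j) := by
    rw [← pow_add, Nat.add_sub_cancel' (Nat.lt_succ_iff.1 (Finset.mem_range.1 hj))]
  rw [this, mul_assoc]

/-- Summing the Carlson bounds by parity gives M ≤ (1 - A₀² - N) r/(1 - r) - N/(1 + A₀). The total
coefficient of -N, namely r/(1 - r) + 1/(1 + A₀), is exactly the factor multiplying N in the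
statement. -/
lemma sum_add_sumSq_le_of_carlson {A : ℕ → ℝ} {r M N : ℝ} (hA : 0 ≤ A 0) (h0 : 0 ≤ r) (h1 : r < 1)
    (hM : HasSum (fun n => A (n + 1) * r ^ (n + 1)) M)
    (hN : HasSum (fun n => A (n + 1) ^ 2 * r ^ (2 * (n + 1))) N)
    (hodd : ∀ n, A (2 * n + 1) ≤ 1 - ∑ j ∈ Finset.range (n + 1), A j ^ 2)
    (heven : ∀ n, A (2 * n + 2) ≤ 1 - ∑ j ∈ Finset.range (n + 1), A j ^ 2
      - A (n + 1) ^ 2 / (1 + A 0)) :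
    M + 1 / (1 + A 0) * ((1 + A 0 * r) / (1 - r)) * N ≤ (1 - A 0 ^ 2) * (r / (1 - r)) := by
  have hx : r ^ 2 < 1 := by nlinarith
  have hN' : HasSum (fun n => A n ^ 2 * (r ^ 2) ^ n) (N + A 0 ^ 2) := by
    rw [← hasSum_nat_add_iff' 1]
    simpa [← pow_mul] using hN
  have hQ := (hasSum_geometric_of_lt_one (sq_nonneg r) hx).sub
    (hasSum_partialSum_mul_pow (sq_nonneg r) hx hN')
  set f : ℕ → ℝ := fun n => A (n + 1) * r ^ (n + 1)
  have hs1 : HasSum (fun n => f (2 * n)) (∑' n, f (2 * n)) :=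
    (hM.summable.comp_injective (mul_right_injective₀ two_ne_zero)).hasSum
  have hs2 : HasSum (fun n => f (2 * n + 1)) (∑' n, f (2 * n + 1)) :=
    (hM.summable.comp_injective
      ((add_left_injective 1).comp (mul_right_injective₀ two_ne_zero))).hasSum
  have hsplit := HasSum.unique (HasSum.even_add_odd (f := f) hs1 hs2) hM
  -- Since f starts at coefficient 1, its even positions carry the odd-index coefficients.
  have ho := hasSum_le (fun n => by
    have := mul_le_mul_of_nonneg_right (hodd n) (pow_nonneg h0 (2 * n + 1))
    refine this.trans (le_of_eq ?_)
    rw [pow_succ, pow_mul]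
    ring) hs1 (hQ.mul_left r)
  have he := hasSum_le (fun n => by
    have := mul_le_mul_of_nonneg_right (heven n) (pow_nonneg h0 (2 * n + 2))
    refine this.trans (le_of_eq ?_)
    rw [mul_add, pow_add, pow_mul]
    ring) hs2 ((hQ.mul_left (r ^ 2)).sub (hN.div_const (1 + A 0)))
  have h2 : (0 : ℝ) < 1 - r := by linarith
  have h3 : (0 : ℝ) < 1 + r := by linarith
  have h4 : (1 - r ^ 2 : ℝ) = (1 - r) * (1 + r) := by ring
  have h5 : r * ((1 - r ^ 2)⁻¹ - (N + A 0 ^ 2) * (1 - r ^ 2)⁻¹)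
      + (r ^ 2 * ((1 - r ^ 2)⁻¹ - (N + A 0 ^ 2) * (1 - r ^ 2)⁻¹) - N / (1 + A 0))
      + 1 / (1 + A 0) * ((1 + A 0 * r) / (1 - r)) * N = (1 - A 0 ^ 2) * (r / (1 - r)) := by
    rw [h4]
    field_simp
    ring
  rw [← hsplit, ← h5]
  exact add_le_add (add_le_add ho he) le_rfl

/-- The sharp coefficient inequality for bounded analytic functions, valid for all `r < 1`. -/
lemma majorant_add_normSq_le {h : ℂ → ℂ} (hh : InB h) {r : ℝ} (h0 : 0 ≤ r) (h1 : r < 1) :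
    majorant h r + 1 / (1 + ‖coeff h 0‖) * ((1 + ‖coeff h 0‖ * r) / (1 - r)) * normSq h r
      ≤ (1 - ‖coeff h 0‖ ^ 2) * (r / (1 - r)) :=
  sum_add_sumSq_le_of_carlson (A := fun n => ‖coeff h n‖) (norm_nonneg _) h0 h1
    (hasSum_majorant hh.analytic h0 h1) (hasSum_normSq hh.analytic h0 h1)
    (norm_coeff_odd_le hh) (norm_coeff_even_le hh)

/-! ### Comparison of the quadratic sums of g and h -/

/-- Integrate termwise over [0, x] and divide by x; x = 0 is separate. Summability is part of the
conclusion so that the lemma can be iterated. -/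
lemma integral_nonneg_of_powerSeries_nonneg {d : ℕ → ℝ}
    (hs : ∀ x : ℝ, 0 ≤ x → x < 1 → Summable fun n => d n * x ^ n)
    (hd : ∀ x : ℝ, 0 ≤ x → x < 1 → 0 ≤ ∑' n, d n * x ^ n) {x : ℝ} (h0 : 0 ≤ x) (h1 : x < 1) :
    Summable (fun n => d n / (n + 1) * x ^ n) ∧ 0 ≤ ∑' n, d n / (n + 1) * x ^ n := by
  have hsum : Summable (fun n => d n / (n + 1) * x ^ n) := by
    refine Summable.of_norm_bounded (hs x h0 h1).norm fun n => ?_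
    rw [norm_mul, norm_mul, norm_div]
    have : (1 : ℝ) ≤ ‖(n + 1 : ℝ)‖ := by
      rw [Real.norm_of_nonneg (by positivity)]; linarith [n.cast_nonneg (α := ℝ)]
    gcongr
    exact div_le_self (norm_nonneg _) this
  refine ⟨hsum, ?_⟩
  rcases h0.eq_or_lt with rfl | hx
  · have := hd 0 le_rfl one_pos
    rw [tsum_eq_single 0 (fun n hn => by simp [hn])] at this ⊢
    simpa using this
  have hint := intervalIntegral.hasSum_intervalIntegral_of_summable_norm (a := 0) (b := x)
    (f := fun n => (⟨fun t => d n * t ^ n, by fun_prop⟩ : C(ℝ, ℝ))) ?_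
  · have h2 : HasSum (fun n : ℕ => x * (d n / (n + 1) * x ^ n)) (∫ t in (0)..x, ∑' n, d n * t ^ n) := by
      refine hint.congr_fun fun n => ?_
      simp [integral_pow]
      ring
    have h3 := h2.unique (hsum.hasSum.mul_left x)
    have h4 : 0 ≤ ∫ t in (0)..x, ∑' n, d n * t ^ n :=
      intervalIntegral.integral_nonneg h0 fun t ht => hd t ht.1 (ht.2.trans_lt h1)
    rw [h3] at h4
    exact nonneg_of_mul_nonneg_right h4 hx
  · refine Summable.of_nonneg_of_le (fun _ => norm_nonneg _) (fun n => ?_) (hs x h0 h1).norm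
    refine (ContinuousMap.norm_le _ (norm_nonneg _)).2 fun t => ?_
    have ht : (t : ℝ) ∈ Set.Icc 0 x := Set.uIcc_of_le h0 ▸ t.2
    simp only [ContinuousMap.restrict_apply, ContinuousMap.coe_mk, norm_mul, norm_pow]
    rw [Real.norm_of_nonneg ht.1, Real.norm_of_nonneg h0]
    have := ht.1
    have := ht.2
    gcongr

/-- Parseval for g' and kh' compares sums carrying the factor (n+1)². Two integrations in x = r²
remove it. -/
lemma normSq_le_of_deriv_le {h g : ℂ → ℂ} (hh : DifferentiableOn ℂ h unitDisk)
    (hg : DifferentiableOn ℂ g unitDisk) {k : ℝ} (hk : 0 ≤ k)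
    (hd : ∀ z ∈ unitDisk, ‖deriv g z‖ ≤ k * ‖deriv h z‖) {r : ℝ} (h0 : 0 ≤ r) (h1 : r < 1) :
    normSq g r ≤ k ^ 2 * normSq h r := by
  have hh' := hh.deriv isOpen_unitDisk
  have hg' := hg.deriv isOpen_unitDisk
  have hkh : DifferentiableOn ℂ (fun z => (k : ℂ) * deriv h z) unitDisk := hh'.const_mul _
  have hc (n : ℕ) : ‖coeff (fun z => (k : ℂ) * deriv h z) n‖ = k * ((n + 1) * ‖coeff h (n + 1)‖) := by
    have : coeff (fun z => (k : ℂ) * deriv h z) n = k * coeff (deriv h) n := by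
      refine coeff_eq_of_hasSum (c := fun n => k * coeff (deriv h) n) (fun z hz => ?_) n
      simpa only [mul_assoc] using (hasSum_coeff hh' hz).mul_left (k : ℂ)
    rw [this, coeff_deriv, norm_mul, norm_mul, Complex.norm_real, Real.norm_of_nonneg hk]
    congr 2
    exact_mod_cast Complex.norm_natCast (n + 1)
  have hc' (n : ℕ) : ‖coeff (deriv g) n‖ = (n + 1) * ‖coeff g (n + 1)‖ := by
    rw [coeff_deriv, norm_mul]
    congr 1
    exact_mod_cast Complex.norm_natCast (n + 1)
  set d : ℕ → ℝ := fun n => (k * ((n + 1) * ‖coeff h (n + 1)‖)) ^ 2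
    - ((n + 1) * ‖coeff g (n + 1)‖) ^ 2 with hdd
  have e1 (x : ℝ) (hx : 0 ≤ x) (hx1 : x < 1) := summable_normSq_coeff hkh hx hx1
  have e2 (x : ℝ) (hx : 0 ≤ x) (hx1 : x < 1) := summable_normSq_coeff hg' hx hx1
  simp only [hc, hc'] at e1 e2
  have hs (x : ℝ) (hx : 0 ≤ x) (hx1 : x < 1) : Summable fun n => d n * x ^ n := by
    simpa only [hdd, sub_mul] using (e1 x hx hx1).sub (e2 x hx hx1)
  have hpos (x : ℝ) (hx : 0 ≤ x) (hx1 : x < 1) : 0 ≤ ∑' n, d n * x ^ n := by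
    have := tsum_normSq_coeff_le hg' hkh (Real.sqrt_nonneg x)
      ((Real.sqrt_lt' one_pos).2 (by simpa using hx1)) fun z hz => ?_
    · rw [Real.sq_sqrt hx] at this
      simp only [hc, hc'] at this
      simp only [hdd, sub_mul]
      rw [(e1 x hx hx1).tsum_sub (e2 x hx hx1)]
      linarith
    · rw [norm_mul, Complex.norm_real, Real.norm_of_nonneg hk]
      refine hd z (mem_unitDisk.2 ?_)
      rw [hz]
      exact (Real.sqrt_lt' one_pos).2 (by simpa using hx1)
  have hd1 (x : ℝ) (hx : 0 ≤ x) (hx1 : x < 1) :=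
    integral_nonneg_of_powerSeries_nonneg hs hpos hx hx1
  have hd2 := (integral_nonneg_of_powerSeries_nonneg (fun x hx hx1 => (hd1 x hx hx1).1)
    (fun x hx hx1 => (hd1 x hx hx1).2) (sq_nonneg r) (show r ^ 2 < 1 by nlinarith)).2
  have hfin := ((hasSum_normSq hh h0 h1).mul_left (k ^ 2)).sub (hasSum_normSq hg h0 h1)
  have h3 : k ^ 2 * normSq h r - normSq g r
      = r ^ 2 * ∑' n : ℕ, d n / (n + 1) / (n + 1) * (r ^ 2) ^ n := by
    rw [← tsum_mul_left, ← hfin.tsum_eq]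
    refine tsum_congr fun n => ?_
    have : (n + 1 : ℝ) ≠ 0 := by positivity
    simp only [hdd]
    field_simp
    ring
  nlinarith [mul_nonneg (sq_nonneg r) hd2]

/-! ### Bounded quotients and Schwarz–Pick -/

/-- Zeros of H are isolated and F/H is bounded near them, so the singularities are removable. -/
lemma exists_bounded_quotient {F H : ℂ → ℂ} (hF : DifferentiableOn ℂ F unitDisk)
    (hH : DifferentiableOn ℂ H unitDisk) (hH0 : ∃ z ∈ unitDisk, H z ≠ 0)
    (hle : ∀ z ∈ unitDisk, ‖F z‖ ≤ ‖H z‖) :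
    ∃ w, InB w ∧ ∀ z ∈ unitDisk, F z = w z * H z := by
  have hHan := hH.analyticOnNhd isOpen_unitDisk
  have hne (c : ℂ) (hc : c ∈ unitDisk) : ∀ᶠ z in 𝓝[≠] c, H z ≠ 0 := by
    refine (hHan c hc).eventually_eq_zero_or_eventually_ne_zero.resolve_left fun h0 => ?_
    obtain ⟨z, hz, hz0⟩ := hH0
    exact hz0 (hHan.eqOn_zero_of_preconnected_of_eventuallyEq_zero
      (convex_ball (0 : ℂ) 1).isPreconnected hc h0 hz)
  have hmem (c : ℂ) (hc : c ∈ unitDisk) : ∀ᶠ z in 𝓝[≠] c, z ∈ unitDisk :=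
    mem_nhdsWithin_of_mem_nhds (isOpen_unitDisk.mem_nhds hc)
  set q : ℂ → ℂ := fun z => F z / H z with hq
  -- At a zero of H the quotient is 0 by convention, so the bound holds there too.
  have hqb (z : ℂ) (hz : z ∈ unitDisk) : ‖q z‖ ≤ 1 := by
    rw [hq, norm_div]
    exact div_le_one_of_le₀ (hle z hz) (norm_nonneg _)
  have hqd (z : ℂ) (hz : z ∈ unitDisk) (h0 : H z ≠ 0) : DifferentiableAt ℂ q z :=
    (hF.differentiableAt (isOpen_unitDisk.mem_nhds hz)).div
      (hH.differentiableAt (isOpen_unitDisk.mem_nhds hz)) h0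
  set w : ℂ → ℂ := fun c => limUnder (𝓝[≠] c) q with hw
  have hlim (c : ℂ) (hc : c ∈ unitDisk) : Tendsto q (𝓝[≠] c) (𝓝 (w c)) := by
    refine Complex.tendsto_limUnder_of_differentiable_on_punctured_nhds_of_bounded_under ?_ ?_
    · filter_upwards [hne c hc, hmem c hc] with z h0 hz using hqd z hz h0
    · refine ⟨2, eventually_map.2 ?_⟩
      filter_upwards [hmem c hc] with z hz
      linarith [norm_sub_le (q z) (q c), hqb z hz, hqb c hc]
  have hwq (z : ℂ) (hz : z ∈ unitDisk) (h0 : H z ≠ 0) : w z = q z :=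
    tendsto_nhds_unique (hlim z hz)
      ((hqd z hz h0).continuousAt.tendsto.mono_left nhdsWithin_le_nhds)
  have hwq' (c : ℂ) (hc : c ∈ unitDisk) : q =ᶠ[𝓝[≠] c] w := by
    filter_upwards [hne c hc, hmem c hc] with z h0 hz using (hwq z hz h0).symm
  refine ⟨w, ⟨fun c hc => ?_, fun c hc => ?_⟩, fun c hc => ?_⟩
  · refine (Complex.analyticAt_of_differentiable_on_punctured_nhds_of_continuousAt ?_
      ?_).differentiableAt.differentiableWithinAt
    · filter_upwards [hne c hc, hmem c hc] with z h0 hz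
      refine (hqd z hz h0).congr_of_eventuallyEq ?_
      have hc0 := (hH.differentiableAt (isOpen_unitDisk.mem_nhds hz)).continuousAt.eventually_ne h0
      filter_upwards [hc0, isOpen_unitDisk.mem_nhds hz] with y hy0 hy using hwq y hy hy0
    · exact continuousWithinAt_compl_self.1 ((hlim c hc).congr' (hwq' c hc))
  · refine le_of_tendsto (hlim c hc).norm ?_
    filter_upwards [hmem c hc] with z hz using hqb z hz
  · have h1 : Tendsto (fun z => q z * H z) (𝓝[≠] c) (𝓝 (w c * H c)) :=
      (hlim c hc).mul ((hH.differentiableAt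
        (isOpen_unitDisk.mem_nhds hc)).continuousAt.tendsto.mono_left nhdsWithin_le_nhds)
    have h2 : Tendsto F (𝓝[≠] c) (𝓝 (F c)) := (hF.differentiableAt
        (isOpen_unitDisk.mem_nhds hc)).continuousAt.tendsto.mono_left nhdsWithin_le_nhds
    refine tendsto_nhds_unique h2 (h1.congr' ?_)
    filter_upwards [hne c hc] with z h0 using div_mul_cancel₀ _ h0

lemma norm_sub_le_norm_one_sub {a b : ℂ} (ha : ‖a‖ ≤ 1) (hb : ‖b‖ ≤ 1) :
    ‖b - a‖ ≤ ‖1 - conj a * b‖ := by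
  have h1 : ‖1 - conj a * b‖ ^ 2 - ‖b - a‖ ^ 2 = (1 - ‖a‖ ^ 2) * (1 - ‖b‖ ^ 2) := by
    simp only [← Complex.normSq_eq_norm_sq, Complex.normSq_apply]
    simp
    ring
  have h2 : 0 ≤ (1 - ‖a‖ ^ 2) * (1 - ‖b‖ ^ 2) :=
    mul_nonneg (by nlinarith [norm_nonneg a]) (by nlinarith [norm_nonneg b])
  exact (sq_le_sq₀ (norm_nonneg _) (norm_nonneg _)).1 (by linarith)

/-- The **Schwarz–Pick lemma** at the origin. -/
lemma norm_sub_apply_zero_le {w : ℂ → ℂ} (hw : InB w) (h0 : ‖w 0‖ < 1) {z : ℂ} (hz : ‖z‖ < 1) :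
    ‖w z - w 0‖ ≤ ‖z‖ * ‖1 - conj (w 0) * w z‖ := by
  have hne (z : ℂ) (hz : z ∈ unitDisk) : 1 - conj (w 0) * w z ≠ 0 := by
    intro h
    have h1 : ‖conj (w 0) * w z‖ = 1 := by rw [← sub_eq_zero.1 h, norm_one]
    rw [norm_mul, RCLike.norm_conj] at h1
    nlinarith [hw.bound z hz, norm_nonneg (w 0), norm_nonneg (w z)]
  have := Complex.norm_le_norm_of_mapsTo_ball (R := 1) (z := z)
    (f := fun z => (w z - w 0) / (1 - conj (w 0) * w z))
    ((hw.analytic.sub_const _).div ((hw.analytic.const_mul _).const_sub _) hne)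
    (fun y hy => by
      rw [mem_closedBall_zero_iff, norm_div]
      exact div_le_one_of_le₀ (norm_sub_le_norm_one_sub h0.le (hw.bound y hy)) (norm_nonneg _))
    (by simp) hz
  rw [norm_div, div_le_iff₀ (norm_pos_iff.2 (hne z (mem_unitDisk.2 hz)))] at this
  exact this

lemma norm_coeff_zero_le_one {w : ℂ → ℂ} (hw : InB w) : ‖coeff w 0‖ ≤ 1 := by
  rw [coeff_zero]
  exact hw.bound 0 (by simp [mem_unitDisk])

/-- Parseval applied to the Schwarz–Pick bound |w - w(0)| ≤ r|1 - conj(w(0)) w| on the circle of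
radius r. -/
lemma normSq_le_of_inB {w : ℂ → ℂ} (hw : InB w) (hx : ‖coeff w 0‖ < 1) {r : ℝ}
    (h0 : 0 ≤ r) (h1 : r < 1) :
    normSq w r ≤ r ^ 2 * ((1 - ‖coeff w 0‖ ^ 2) ^ 2 + ‖coeff w 0‖ ^ 2 * normSq w r) := by
  have hu : DifferentiableOn ℂ (subAtZero w) unitDisk := hw.analytic.sub_const _
  set v : ℂ → ℂ := fun z => (r : ℂ) * (1 - conj (w 0) * w z) with hv
  have hvd : DifferentiableOn ℂ v unitDisk :=
    ((hw.analytic.const_mul _).const_sub _).const_mul _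
  have hvc (n : ℕ) : coeff v n = r * ((if n = 0 then 1 else 0) - conj (w 0) * coeff w n) := by
    refine coeff_eq_of_hasSum
      (c := fun n => r * ((if n = 0 then 1 else 0) - conj (w 0) * coeff w n)) (fun z hz => ?_) n
    have h2 := ((hasSum_ite_eq (0 : ℕ) (1 : ℂ)).sub
      ((hasSum_coeff hw.analytic hz).mul_left (conj (w 0)))).mul_left (r : ℂ)
    refine h2.congr_fun fun n => ?_
    rcases eq_or_ne n 0 with rfl | hn
    · simp
    · simp [hn]; ring
  have hmain := tsum_normSq_coeff_le hu hvd h0 h1 fun z hz => by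
    rw [hv, norm_mul, Complex.norm_real, Real.norm_of_nonneg h0, ← hz]
    exact norm_sub_apply_zero_le hw (by rwa [← coeff_zero w]) (hz ▸ h1)
  rw [(hasSum_normSq_add hu h0 h1).tsum_eq, normSq_subAtZero, coeff_subAtZero_zero,
    (hasSum_normSq_add hvd h0 h1).tsum_eq] at hmain
  have hc0 : ‖coeff v 0‖ = r * (1 - ‖coeff w 0‖ ^ 2) := by
    have : coeff v 0 = ((r * (1 - ‖coeff w 0‖ ^ 2) : ℝ) : ℂ) := by
      rw [hvc, if_pos rfl, ← coeff_zero w, mul_comm (conj _), Complex.mul_conj,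
        Complex.normSq_eq_norm_sq]
      push_cast
      rfl
    rw [this, Complex.norm_real, Real.norm_of_nonneg]
    exact mul_nonneg h0 (by nlinarith [norm_nonneg (coeff w 0)])
  have hcn : normSq v r = r ^ 2 * (‖coeff w 0‖ ^ 2 * normSq w r) := by
    rw [normSq, normSq, ← tsum_mul_left, ← tsum_mul_left]
    refine tsum_congr fun n => ?_
    rw [hvc, if_neg n.succ_ne_zero, zero_sub, norm_mul, norm_neg, norm_mul, RCLike.norm_conj,
      Complex.norm_real, Real.norm_of_nonneg h0, ← coeff_zero w]
    ring
  rw [hc0, hcn] at hmain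
  simp only [norm_zero] at hmain
  nlinarith

/-! ### The Bohr radius with prescribed value at the origin -/

lemma sum_norm_sq_coeff_le_one {w : ℂ → ℂ} (hw : InB w) (N : ℕ) :
    ∑ m ∈ Finset.range N, ‖coeff w m‖ ^ 2 ≤ 1 := by
  simpa using sum_norm_sq_coeff_mul_polynomial_le hw 1 N

/-- With x = |w(0)|, sum 2|w_n|rⁿ ≤ |w_n|²/(1 + x) + (1 + x)r²ⁿ over n ≥ 1. Each resulting sum is at
most 1 - x: the first as Σ|w_n|² ≤ 1 - x², the second by the hypothesis on r. -/
lemma majorant_le_of_two_mul_sq_le {w : ℂ → ℂ} (hw : InB w) {r : ℝ} (h0 : 0 ≤ r)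
    (hr : 2 * r ^ 2 ≤ 1 - ‖coeff w 0‖) : majorant w r ≤ 1 - ‖coeff w 0‖ := by
  have hx := norm_nonneg (coeff w 0)
  have h1 : r < 1 := by nlinarith
  have hs : Summable (fun n => ‖coeff w n‖ ^ 2) :=
    summable_of_sum_range_le (fun n => by positivity) (sum_norm_sq_coeff_le_one hw)
  have hle : ∑' n, ‖coeff w (n + 1)‖ ^ 2 ≤ 1 - ‖coeff w 0‖ ^ 2 := by
    have h2 := hs.tsum_le_of_sum_range_le (sum_norm_sq_coeff_le_one hw)
    rw [hs.tsum_eq_zero_add] at h2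
    linarith
  have hs' := ((summable_nat_add_iff 1).2 hs).hasSum
  have hx2 : r ^ 2 < 1 := by nlinarith
  have hg := (hasSum_geometric_of_lt_one (sq_nonneg r) hx2).mul_left (r ^ 2)
  set x := ‖coeff w 0‖ with hxdef
  have hb := (hs'.mul_left (1 / (1 + x))).add (hg.mul_left (1 + x))
  have h3 := hasSum_le (fun n => ?_) ((hasSum_majorant hw.analytic h0 h1).mul_left 2) hb
  · have h4 : r ^ 2 * (1 - r ^ 2)⁻¹ * (1 + x) ≤ 1 - x := by
      rw [← div_eq_mul_inv, div_mul_eq_mul_div, div_le_iff₀ (by linarith)]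
      nlinarith
    have h5 : 1 / (1 + x) * ∑' n, ‖coeff w (n + 1)‖ ^ 2 ≤ 1 - x := by
      rw [one_div, inv_mul_le_iff₀ (by linarith)]
      linarith
    linarith
  · have h4 : 0 ≤ 1 / (1 + x) * (‖coeff w (n + 1)‖ - (1 + x) * r ^ (n + 1)) ^ 2 := by positivity
    refine sub_nonneg.1 (h4.trans (le_of_eq ?_))
    field_simp
    ring

/-- A weighted arithmetic–geometric mean inequality, tight when |w_n| = (1 - x²)xⁿ⁻¹ as for a disk
automorphism. The quadratic part is `normSq` at radius √(r/x), which is below 1 because r < x. -/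
lemma majorant_le_of_lt {w : ℂ → ℂ} (hw : InB w) (hx0 : 0 < ‖coeff w 0‖) (hx1 : ‖coeff w 0‖ < 1)
    {r : ℝ} (h0 : 0 ≤ r) (hr : r < ‖coeff w 0‖) :
    majorant w r ≤ r * (1 - ‖coeff w 0‖ ^ 2) / (1 - r * ‖coeff w 0‖) := by
  set x := ‖coeff w 0‖ with hx
  have h1 : r < 1 := hr.trans hx1
  have hR : r / x < 1 := (div_lt_one hx0).2 hr
  have hR0 : 0 ≤ r / x := by positivity
  have hs0 : 0 ≤ √(r / x) := Real.sqrt_nonneg _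
  have hs1 : √(r / x) < 1 := (Real.sqrt_lt' one_pos).2 (by simpa using hR)
  have hN := normSq_le_of_inB hw hx1 hs0 hs1
  have hNs := hasSum_normSq hw.analytic hs0 hs1
  set N := normSq w (√(r / x))
  simp only [pow_mul, Real.sq_sqrt hR0] at hN hNs
  rw [← hx] at hN
  have hrx : r * x < 1 := by nlinarith
  have hx2 : 0 < 1 - x ^ 2 := by nlinarith
  have hN' : N * x * (1 - r * x) ≤ r * (1 - x ^ 2) ^ 2 := by
    have h2 := mul_le_mul_of_nonneg_right hN hx0.le
    have h3 : r / x * ((1 - x ^ 2) ^ 2 + x ^ 2 * N) * x = r * ((1 - x ^ 2) ^ 2 + x ^ 2 * N) := by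
      field_simp
    rw [h3] at h2
    linarith
  have hg := (hasSum_geometric_of_lt_one (by positivity) hrx).mul_left (r * x)
  have hb := (hNs.mul_left (x / (1 - x ^ 2))).add (hg.mul_left ((1 - x ^ 2) / x))
  have h3 := hasSum_le (fun n => ?_) ((hasSum_majorant hw.analytic h0 h1).mul_left 2) hb
  · have hd : 0 < 1 - r * x := by linarith
    have h4 : (1 - x ^ 2) / x * (r * x * (1 - r * x)⁻¹) = r * (1 - x ^ 2) / (1 - r * x) := by
      field_simp
    have h5 : x / (1 - x ^ 2) * N ≤ r * (1 - x ^ 2) / (1 - r * x) := by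
      rw [div_mul_eq_mul_div, div_le_div_iff₀ hx2 hd]
      linarith
    linarith
  · have h4 : 0 ≤ r ^ (n + 1) * (x / (1 - x ^ 2) / x ^ (n + 1)) *
        (‖coeff w (n + 1)‖ - (1 - x ^ 2) / x * x ^ (n + 1)) ^ 2 := by positivity
    refine sub_nonneg.1 (h4.trans (le_of_eq ?_))
    rw [div_pow]
    field_simp
    ring

lemma radius_lt_one {x : ℝ} (hx : 0 ≤ x) : radius x < 1 := by
  unfold radius
  split_ifs with h
  · exact (Real.sqrt_lt' one_pos).2 (by linarith)
  · rw [div_lt_one (by linarith)]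
    linarith

/-- The Bohr inequality for bounded analytic functions with prescribed value at the origin. -/
lemma majorant_le_of_le_radius {w : ℂ → ℂ} (hw : InB w) {r : ℝ} (h0 : 0 ≤ r)
    (hr : r ≤ radius ‖coeff w 0‖) : majorant w r ≤ 1 - ‖coeff w 0‖ := by
  have hx0 := norm_nonneg (coeff w 0)
  rcases lt_trichotomy ‖coeff w 0‖ (1 / 2) with hx | hx | hx
  · rw [radius, if_pos hx] at hr
    refine majorant_le_of_two_mul_sq_le hw h0 ?_
    have := (Real.le_sqrt h0 (by linarith)).1 hr
    linarith
  -- Here the radius is 1/2 = x, so the strict bound r < x may fail; the estimate for small x still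
  -- applies, since 2r² ≤ 1/2.
  · rw [radius, if_neg (by rw [hx]; exact lt_irrefl _)] at hr
    refine majorant_le_of_two_mul_sq_le hw h0 ?_
    rw [hx] at hr ⊢
    nlinarith
  · rcases (norm_coeff_zero_le_one hw).eq_or_lt with hx1 | hx1
    · have hz (n : ℕ) : ‖coeff w (n + 1)‖ = 0 := by
        have h2 := sum_norm_sq_coeff_le_one hw (n + 1 + 1)
        rw [Finset.sum_range_succ'] at h2
        have h3 := Finset.single_le_sum (f := fun i => ‖coeff w (i + 1)‖ ^ 2)
          (fun i _ => by positivity) (Finset.self_mem_range_succ n)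
        rw [hx1] at h2
        have h4 : ‖coeff w (n + 1)‖ ^ 2 ≤ 0 := by linarith
        nlinarith [norm_nonneg (coeff w (n + 1))]
      simp [majorant, hz, hx1]
    · rw [radius, if_neg hx.not_gt, le_div_iff₀ (by linarith)] at hr
      have hrx : r < ‖coeff w 0‖ := by nlinarith
      refine (majorant_le_of_lt hw (by linarith) hx1 h0 hrx).trans ?_
      rw [div_le_iff₀ (by nlinarith)]
      nlinarith

/-! ### From the analytic part to the harmonic mapping -/

lemma eqOn_const_of_deriv_eq_zero {F : ℂ → ℂ} (hF : DifferentiableOn ℂ F unitDisk)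
    (hd : ∀ z ∈ unitDisk, deriv F z = 0) {z : ℂ} (hz : z ∈ unitDisk) : F z = F 0 :=
  isOpen_unitDisk.is_const_of_deriv_eq_zero (convex_ball (0 : ℂ) 1).isPreconnected hF
    (fun y hy => hd y hy) hz (by simp [mem_unitDisk])

lemma zeroOrder_spec {h : ℂ → ℂ} (hh : DifferentiableOn ℂ h unitDisk) (hn : Nonconstant h) :
    ∃ q, zeroOrder h = q + 1 ∧ (∀ j < q, coeff h (j + 1) = 0) ∧ coeff h (q + 1) ≠ 0 := by
  have h0 : (0 : ℂ) ∈ unitDisk := by simp [mem_unitDisk]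
  have hs : DifferentiableOn ℂ (subAtZero h) unitDisk := hh.sub_const _
  have han := hs.analyticOnNhd isOpen_unitDisk
  have htop : analyticOrderAt (subAtZero h) 0 ≠ ⊤ := by
    intro ht
    refine hn ⟨h 0, fun z hz => ?_⟩
    exact sub_eq_zero.1 (han.eqOn_zero_of_preconnected_of_eventuallyEq_zero
      (convex_ball (0 : ℂ) 1).isPreconnected h0 (analyticOrderAt_eq_top.1 ht) hz)
  have hord : analyticOrderAt (subAtZero h) 0 = (zeroOrder h : ℕ∞) :=
    (Nat.cast_analyticOrderNatAt htop).symm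
  obtain ⟨hlt, hne⟩ := (analyticOrderAt_eq_nat_iff_iteratedDeriv_eq_zero (han 0 h0)).1 hord
  cases hq : zeroOrder h with
  | zero => rw [hq] at hne; simp [subAtZero] at hne
  | succ q =>
    rw [hq] at hlt hne
    refine ⟨q, rfl, fun j hj => ?_, ?_⟩
    · rw [← coeff_subAtZero_succ, coeff, hlt (j + 1) (by omega), zero_div]
    · rw [← coeff_subAtZero_succ, coeff]
      exact div_ne_zero hne (by exact_mod_cast (q + 1).factorial_ne_zero)

lemma coeff_succ_eq_of_deriv_eq {k : ℝ} {h g w : ℂ → ℂ} (hh : DifferentiableOn ℂ h unitDisk)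
    (hw : DifferentiableOn ℂ w unitDisk)
    (hd : ∀ z ∈ unitDisk, deriv g z = w z * (k * deriv h z)) (n : ℕ) :
    (n + 1) * coeff g (n + 1) = k * ∑ p ∈ Finset.HasAntidiagonal.antidiagonal n,
      (p.1 + 1) * coeff h (p.1 + 1) * coeff w p.2 := by
  have hh' := hh.deriv isOpen_unitDisk
  have hprod := hh'.fun_mul hw
  rw [← coeff_deriv]
  refine coeff_eq_of_hasSum (c := fun n => k * ∑ p ∈ Finset.HasAntidiagonal.antidiagonal n,
      (p.1 + 1) * coeff h (p.1 + 1) * coeff w p.2) (fun z hz => ?_) n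
  have := (hasSum_coeff hprod hz).mul_left (k : ℂ)
  rw [hd z (mem_unitDisk.2 hz), show w z * (k * deriv h z) = k * (deriv h z * w z) by ring]
  refine this.congr_fun fun n => ?_
  rw [coeff_mul hh' hw, mul_assoc]
  simp only [coeff_deriv]

/-- In the Cauchy product for g' = k w h', each factor (p.1 + 1)/(n + 1) is at most 1. Dropping it
bounds the coefficients of g by those of a product of majorants. -/
lemma majorant_le_of_deriv_eq {k : ℝ} (hk : 0 ≤ k) {h g w : ℂ → ℂ}
    (hh : DifferentiableOn ℂ h unitDisk) (hg : DifferentiableOn ℂ g unitDisk)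
    (hw : DifferentiableOn ℂ w unitDisk)
    (hd : ∀ z ∈ unitDisk, deriv g z = w z * (k * deriv h z)) {r : ℝ} (h0 : 0 ≤ r) (h1 : r < 1) :
    majorant g r ≤ k * (majorant h r * (‖coeff w 0‖ + majorant w r)) := by
  have hW : HasSum (fun n => ‖coeff w n‖ * r ^ n) (majorant w r + ‖coeff w 0‖) := by
    rw [← hasSum_nat_add_iff' 1]
    simpa using hasSum_majorant hw h0 h1
  have hM := hasSum_majorant hh h0 h1
  have hs1 := hM.summable.norm
  have hs2 := hW.summable.norm
  have hP := (summable_norm_sum_mul_antidiagonal_of_summable_norm hs1 hs2).of_norm.hasSum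
  rw [← tsum_mul_tsum_eq_tsum_sum_antidiagonal_of_summable_norm hs1 hs2, hM.tsum_eq, hW.tsum_eq,
    add_comm (majorant w r)] at hP
  refine hasSum_le (fun n => ?_) (hasSum_majorant hg h0 h1) (hP.mul_left k)
  have hpos : (0 : ℝ) < n + 1 := by positivity
  have hcast (m : ℕ) : ‖(m + 1 : ℂ)‖ = m + 1 := by exact_mod_cast Complex.norm_natCast (m + 1)
  have hc : (n + 1) * ‖coeff g (n + 1)‖ ≤ (n + 1) *
      (k * ∑ p ∈ Finset.HasAntidiagonal.antidiagonal n, ‖coeff h (p.1 + 1)‖ * ‖coeff w p.2‖) := by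
    rw [← hcast n, ← norm_mul, coeff_succ_eq_of_deriv_eq hh hw hd, norm_mul, Complex.norm_real,
      Real.norm_of_nonneg hk, mul_left_comm, hcast n, Finset.mul_sum]
    refine mul_le_mul_of_nonneg_left ((norm_sum_le _ _).trans (Finset.sum_le_sum fun p hp => ?_)) hk
    rw [norm_mul, norm_mul, hcast, mul_assoc]
    have : (p.1 : ℝ) ≤ n := by
      have := Finset.HasAntidiagonal.mem_antidiagonal.1 hp
      exact_mod_cast (show p.1 ≤ n by omega)
    gcongr
  have := mul_le_mul_of_nonneg_right (le_of_mul_le_mul_left hc hpos) (pow_nonneg h0 (n + 1))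
  refine this.trans (le_of_eq ?_)
  rw [mul_assoc, Finset.sum_mul]
  congr 1
  refine Finset.sum_congr rfl fun p hp => ?_
  rw [← Finset.HasAntidiagonal.mem_antidiagonal.1 hp]
  ring

lemma E_le {k : ℝ} {f h g : ℂ → ℂ} (hk : 0 < k) (hf : InHk k f h g) (hn : Nonconstant h) {r : ℝ}
    (h0 : 0 ≤ r) (hr : r ≤ radius (‖coeff g (zeroOrder h)‖ / (k * ‖coeff h (zeroOrder h)‖))) :
    E h g k r ≤ (1 - ‖coeff h 0‖ ^ 2) * (1 + k) * (r / (1 - r)) := by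
  have hh := hf.analytic_h
  have hg := hf.analytic_g
  have hkC : (k : ℂ) ≠ 0 := by exact_mod_cast hk.ne'
  obtain ⟨w, hw, hwd⟩ := exists_bounded_quotient (hg.deriv isOpen_unitDisk)
    (H := fun z => k * deriv h z) ((hh.deriv isOpen_unitDisk).const_mul _) (by
      by_contra! hcon
      refine hn ⟨h 0, fun z hz => eqOn_const_of_deriv_eq_zero hh (fun y hy => ?_) hz⟩
      exact (mul_eq_zero.1 (hcon y hy)).resolve_left hkC) (fun z hz => by
      rw [norm_mul, Complex.norm_real, Real.norm_of_nonneg hk.le]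
      exact hf.deriv_le z hz)
  obtain ⟨q, hq, hlt, hne⟩ := zeroOrder_spec hh hn
  have hgq : coeff g (q + 1) = k * coeff h (q + 1) * coeff w 0 := by
    have h2 := coeff_succ_eq_of_deriv_eq hh hw.analytic hwd q
    -- All terms with p.1 < q contain a vanishing coefficient of h, leaving only w(0).
    rw [Finset.sum_eq_single (q, 0)] at h2
    · have h3 : (q + 1 : ℂ) ≠ 0 := by exact_mod_cast q.succ_ne_zero
      refine mul_left_cancel₀ h3 (h2.trans ?_)
      ring
    · intro p hp hne
      have h3 := Finset.HasAntidiagonal.mem_antidiagonal.1 hp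
      have h4 : p.1 < q := by
        rcases (show p.1 ≤ q by omega).eq_or_lt with h5 | h5
        · exact absurd (Prod.ext h5 (by simp; omega)) hne
        · exact h5
      rw [hlt _ h4]
      ring
    · intro h3
      exact absurd (Finset.HasAntidiagonal.mem_antidiagonal.2 (by simp)) h3
  have hx : ‖coeff g (zeroOrder h)‖ / (k * ‖coeff h (zeroOrder h)‖) = ‖coeff w 0‖ := by
    have := norm_pos_iff.2 hne
    rw [hq, hgq, norm_mul, norm_mul, Complex.norm_real, Real.norm_of_nonneg hk.le]
    field_simp
  rw [hx] at hr
  have h1 : r < 1 := hr.trans_lt (radius_lt_one (norm_nonneg _))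
  have hM : majorant g r ≤ k * majorant h r := by
    refine (majorant_le_of_deriv_eq hk.le hh hg hw.analytic hwd h0 h1).trans ?_
    have hMh : 0 ≤ majorant h r := tsum_nonneg fun n => by positivity
    have := majorant_le_of_le_radius hw h0 hr
    exact mul_le_mul_of_nonneg_left (mul_le_of_le_one_right hMh (by linarith)) hk.le
  have hN : weight k * normSq g r ≤ k * normSq h r := by
    rw [weight, if_neg hk.ne', one_div, inv_mul_le_iff₀ hk]
    have := normSq_le_of_deriv_le hh hg hk.le hf.deriv_le h0 h1
    linarith
  have hmain := majorant_add_normSq_le hf.h_mem h0 h1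
  rw [E, normSq_subAtZero]
  have h2 : (0 : ℝ) < 1 - r := by linarith
  set C := 1 / (1 + ‖coeff h 0‖) * ((1 + ‖coeff h 0‖ * r) / (1 - r)) with hC
  have hCpos : 0 ≤ C := by positivity
  have h3 := mul_le_mul_of_nonneg_left hN hCpos
  have h4 := mul_le_mul_of_nonneg_left hmain (show 0 ≤ 1 + k by linarith)
  linarith

lemma E_zero_le {f h g : ℂ → ℂ} (hf : InHk 0 f h g) {r : ℝ} (h0 : 0 ≤ r) (h1 : r < 1) :
    E h g 0 r ≤ (1 - ‖coeff h 0‖ ^ 2) * (1 + 0) * (r / (1 - r)) := by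
  have hd (z : ℂ) (hz : z ∈ unitDisk) : deriv g z = 0 := by
    simpa using hf.deriv_le z hz
  have hc (n : ℕ) : coeff g n = 0 := by
    refine coeff_eq_of_hasSum (c := fun _ => 0) (fun z hz => ?_) n
    rw [eqOn_const_of_deriv_eq_zero hf.analytic_g hd (mem_unitDisk.2 hz), hf.g_zero]
    simp
  have hM : majorant g r = 0 := by simp [majorant, hc]
  have := majorant_add_normSq_le hf.h_mem h0 h1
  rw [E, normSq_subAtZero, hM, weight, if_pos rfl]
  linarith

/-! ### The extremal mappings -/

lemma one_add_mul_ne_zero {a : ℝ} (ha0 : 0 ≤ a) (ha1 : a < 1) {z : ℂ} (hz : ‖z‖ < 1) :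
    1 + (a : ℂ) * z ≠ 0 := by
  intro h
  have h1 : ‖(a : ℂ) * z‖ = 1 := by
    rw [show (a : ℂ) * z = -1 by linear_combination h, norm_neg, norm_one]
  rw [norm_mul, Complex.norm_real, Real.norm_of_nonneg ha0] at h1
  nlinarith [norm_nonneg z]

lemma inB_omega {a : ℝ} (ha0 : 0 ≤ a) (ha1 : a < 1) : InB (omega a) := by
  refine ⟨?_, fun z hz => ?_⟩
  · exact (differentiableOn_id.add_const _).div ((differentiableOn_id.const_mul _).const_add _)
      fun z hz => one_add_mul_ne_zero ha0 ha1 (mem_unitDisk.1 hz)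
  · rw [omega, norm_div]
    refine div_le_one_of_le₀ ?_ (norm_nonneg _)
    have := norm_sub_le_norm_one_sub (a := ((-a : ℝ) : ℂ)) (b := z)
      (by rw [Complex.norm_real, Real.norm_eq_abs, abs_neg, abs_of_nonneg ha0]; exact ha1.le)
      (mem_unitDisk.1 hz).le
    simpa [Complex.conj_ofReal] using this

lemma hasSum_omega {a : ℝ} (ha0 : 0 ≤ a) (ha1 : a < 1) {z : ℂ} (hz : ‖z‖ < 1) :
    HasSum (fun n : ℕ => (1 - (a : ℂ) ^ 2) * (-a : ℂ) ^ n * z ^ (n + 1)) (omega a z - a) := by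
  have hlt : ‖-(a : ℂ) * z‖ < 1 := by
    rw [norm_mul, norm_neg, Complex.norm_real, Real.norm_of_nonneg ha0]
    nlinarith [norm_nonneg z]
  have := (hasSum_geometric_of_norm_lt_one hlt).mul_left ((1 - (a : ℂ) ^ 2) * z)
  have h2 : (1 - (a : ℂ) ^ 2) * z * (1 - -(a : ℂ) * z)⁻¹ = omega a z - a := by
    have := one_add_mul_ne_zero ha0 ha1 hz
    rw [omega, neg_mul, sub_neg_eq_add]
    field_simp
    ring
  rw [h2] at this
  refine this.congr_fun fun n => ?_
  rw [mul_pow]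
  ring

lemma coeff_zero_omega (a : ℝ) : coeff (omega a) 0 = a := by
  simp [coeff_zero, omega]

lemma coeff_succ_const_mul_omega_sub {a : ℝ} (ha0 : 0 ≤ a) (ha1 : a < 1) (c : ℂ) (n : ℕ) :
    coeff (fun z => c * (omega a z - a)) (n + 1) = c * ((1 - (a : ℂ) ^ 2) * (-a : ℂ) ^ n) := by
  refine coeff_eq_of_hasSum (c := fun m => Nat.casesOn m 0
    fun n => c * ((1 - (a : ℂ) ^ 2) * (-a : ℂ) ^ n)) (fun z hz => ?_) (n + 1)
  rw [← hasSum_nat_add_iff' 1]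
  simpa [mul_assoc] using (hasSum_omega ha0 ha1 hz).mul_left c

lemma coeff_succ_omega {a : ℝ} (ha0 : 0 ≤ a) (ha1 : a < 1) (n : ℕ) :
    coeff (omega a) (n + 1) = (1 - (a : ℂ) ^ 2) * (-a : ℂ) ^ n := by
  have h0 : omega a 0 = a := by simp [omega]
  rw [← coeff_subAtZero_succ, ← one_mul ((1 - (a : ℂ) ^ 2) * (-a : ℂ) ^ n),
    ← coeff_succ_const_mul_omega_sub ha0 ha1]
  congr 1
  ext z
  rw [subAtZero, h0, one_mul]

lemma hasSum_majorant_geometric {a k r : ℝ} (ha0 : 0 ≤ a) (ha1 : a < 1) (h0 : 0 ≤ r) (h1 : r < 1) :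
    HasSum (fun n : ℕ => k * ((1 - a ^ 2) * a ^ n) * r ^ (n + 1))
      (k * ((1 - a ^ 2) * r / (1 - a * r))) := by
  have := (hasSum_geometric_of_lt_one (mul_nonneg ha0 h0)
    (show a * r < 1 by nlinarith)).mul_left (k * (1 - a ^ 2) * r)
  rw [show k * ((1 - a ^ 2) * r / (1 - a * r)) = k * (1 - a ^ 2) * r * (1 - a * r)⁻¹ by ring]
  refine this.congr_fun fun n => ?_
  rw [mul_pow]
  ring

lemma hasSum_normSq_geometric {a k r : ℝ} (ha0 : 0 ≤ a) (ha1 : a < 1) (h0 : 0 ≤ r) (h1 : r < 1) :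
    HasSum (fun n : ℕ => (k * ((1 - a ^ 2) * a ^ n)) ^ 2 * r ^ (2 * (n + 1)))
      (k ^ 2 * ((1 - a ^ 2) ^ 2 * r ^ 2 / (1 - (a * r) ^ 2))) := by
  have har : a * r < 1 := by nlinarith
  have := (hasSum_geometric_of_lt_one (sq_nonneg (a * r))
    (by nlinarith [mul_nonneg ha0 h0])).mul_left (k ^ 2 * (1 - a ^ 2) ^ 2 * r ^ 2)
  rw [show k ^ 2 * ((1 - a ^ 2) ^ 2 * r ^ 2 / (1 - (a * r) ^ 2))
    = k ^ 2 * (1 - a ^ 2) ^ 2 * r ^ 2 * (1 - (a * r) ^ 2)⁻¹ by ring]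
  refine this.congr_fun fun n => ?_
  rw [mul_pow a r, mul_pow (a ^ 2), mul_add, pow_add, pow_mul]
  ring

lemma norm_extremal_coeff {a k : ℝ} (ha0 : 0 ≤ a) (ha1 : a < 1) (hk : 0 ≤ k) (n : ℕ) :
    ‖(k : ℂ) * ((1 - (a : ℂ) ^ 2) * (-a : ℂ) ^ n)‖ = k * ((1 - a ^ 2) * a ^ n) := by
  have : ‖(1 - (a : ℂ) ^ 2)‖ = 1 - a ^ 2 := by
    rw [show (1 - (a : ℂ) ^ 2) = ((1 - a ^ 2 : ℝ) : ℂ) by push_cast; rfl, Complex.norm_real,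
      Real.norm_of_nonneg (by nlinarith)]
  rw [norm_mul, norm_mul, norm_pow, norm_neg, this, Complex.norm_real, Complex.norm_real,
    Real.norm_of_nonneg hk, Real.norm_of_nonneg ha0]

lemma E_omega {k a : ℝ} (hk : 0 ≤ k) (ha0 : 0 ≤ a) (ha1 : a < 1) {r : ℝ} (h0 : 0 ≤ r) (h1 : r < 1) :
    E (omega a) (fun z => (k : ℂ) * (omega a z - a)) k r
      = (1 - ‖coeff (omega a) 0‖ ^ 2) * (1 + k) * (r / (1 - r)) := by
  have hMg : majorant (fun z => (k : ℂ) * (omega a z - a)) r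
      = k * ((1 - a ^ 2) * r / (1 - a * r)) := by
    rw [majorant, ← (hasSum_majorant_geometric ha0 ha1 h0 h1).tsum_eq]
    exact tsum_congr fun n => by
      rw [coeff_succ_const_mul_omega_sub ha0 ha1, norm_extremal_coeff ha0 ha1 hk]
  have hNg : normSq (fun z => (k : ℂ) * (omega a z - a)) r
      = k ^ 2 * ((1 - a ^ 2) ^ 2 * r ^ 2 / (1 - (a * r) ^ 2)) := by
    rw [normSq, ← (hasSum_normSq_geometric ha0 ha1 h0 h1).tsum_eq]
    exact tsum_congr fun n => by
      rw [coeff_succ_const_mul_omega_sub ha0 ha1, norm_extremal_coeff ha0 ha1 hk]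
  have hc (n : ℕ) : ‖coeff (omega a) (n + 1)‖ = 1 * ((1 - a ^ 2) * a ^ n) := by
    rw [coeff_succ_omega ha0 ha1, ← norm_extremal_coeff ha0 ha1 zero_le_one, Complex.ofReal_one,
      one_mul]
  have hMh : majorant (omega a) r = (1 - a ^ 2) * r / (1 - a * r) := by
    rw [majorant, ← one_mul ((1 - a ^ 2) * r / (1 - a * r)),
      ← (hasSum_majorant_geometric ha0 ha1 h0 h1).tsum_eq]
    exact tsum_congr fun n => by rw [hc]
  have hNh : normSq (omega a) r = (1 - a ^ 2) ^ 2 * r ^ 2 / (1 - (a * r) ^ 2) := by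
    have h2 := (hasSum_normSq_geometric (k := 1) ha0 ha1 h0 h1).tsum_eq
    rw [one_pow, one_mul] at h2
    rw [normSq, ← h2]
    exact tsum_congr fun n => by rw [hc]
  -- This identity also holds at k = 0, so one computation covers every k.
  have hwt : weight k * k ^ 2 = k := by
    unfold weight
    split_ifs with h
    · simp [h]
    · field_simp
  rw [E, normSq_subAtZero, hMg, hNg, hMh, hNh, coeff_zero_omega, Complex.norm_real,
    Real.norm_of_nonneg ha0, ← mul_assoc (weight k), hwt]
  have har : 0 < 1 - a * r := by nlinarith
  have har' : 0 < 1 + a * r := by positivity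
  have hr : 0 < 1 - r := by linarith
  rw [show 1 - (a * r) ^ 2 = (1 - a * r) * (1 + a * r) by ring]
  field_simp
  ring

lemma nonconstant_omega {a : ℝ} (ha0 : 0 ≤ a) (ha1 : a < 1) : Nonconstant (omega a) := by
  rintro ⟨c, hc⟩
  have h1 : coeff (omega a) (0 + 1) = 0 := by
    rw [← coeff_subAtZero_succ]
    refine coeff_eq_of_hasSum (c := fun _ => 0) (fun z hz => ?_) _
    rw [subAtZero, hc z (mem_unitDisk.2 hz), hc 0 (by simp [mem_unitDisk]), sub_self]
    simp
  rw [coeff_succ_omega ha0 ha1, pow_zero, mul_one] at h1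
  have h2 : 1 - a ^ 2 = 0 := by exact_mod_cast h1
  nlinarith

lemma inHk_omega {k a : ℝ} (hk : 0 ≤ k) (ha0 : 0 ≤ a) (ha1 : a < 1) :
    InHk k (fun z => omega a z + conj ((k : ℂ) * (omega a z - a))) (omega a)
      (fun z => (k : ℂ) * (omega a z - a)) where
  analytic_h := (inB_omega ha0 ha1).analytic
  analytic_g := ((inB_omega ha0 ha1).analytic.sub_const _).const_mul _
  g_zero := by simp [omega]
  decomp _ _ := rfl
  h_mem := inB_omega ha0 ha1
  deriv_le z _ := by
    rw [deriv_const_mul_field, deriv_sub_const, norm_mul, Complex.norm_real,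
      Real.norm_of_nonneg hk]

end BohrHarmonic

theorem lemma5 :
    (∀ (k : ℝ) (f h g : ℂ → ℂ), 0 < k → k ≤ 1 →
      BohrHarmonic.InHk k f h g → BohrHarmonic.Nonconstant h →
      ∀ r : ℝ, 0 ≤ r →
        r ≤ BohrHarmonic.radius
          (‖BohrHarmonic.coeff g (BohrHarmonic.zeroOrder h)‖
            / (k * ‖BohrHarmonic.coeff h (BohrHarmonic.zeroOrder h)‖)) →
        BohrHarmonic.E h g k r
          ≤ (1 - ‖BohrHarmonic.coeff h 0‖ ^ 2) * (1 + k) * (r / (1 - r)))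
    ∧ (∀ f h g : ℂ → ℂ, BohrHarmonic.InHk 0 f h g → BohrHarmonic.Nonconstant h →
      ∀ r : ℝ, 0 ≤ r → r < 1 →
        BohrHarmonic.E h g 0 r
          ≤ (1 - ‖BohrHarmonic.coeff h 0‖ ^ 2) * (1 + 0) * (r / (1 - r)))
    ∧ (∀ k a : ℝ, 0 ≤ k → k ≤ 1 → 0 ≤ a → a < 1 →
      ∀ f h g : ℂ → ℂ,
        h = BohrHarmonic.omega a →
        g = (fun z => (k : ℂ) * (BohrHarmonic.omega a z - (a : ℂ))) →
        f = (fun z => h z + (starRingEnd ℂ) (g z)) →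
        BohrHarmonic.InHk k f h g ∧ BohrHarmonic.Nonconstant h ∧
        ∀ r : ℝ, 0 ≤ r → r < 1 →
          BohrHarmonic.E h g k r
            = (1 - ‖BohrHarmonic.coeff h 0‖ ^ 2) * (1 + k) * (r / (1 - r))) := by
  refine ⟨fun k f h g hk _ hf hn r h0 hr => BohrHarmonic.E_le hk hf hn h0 hr,
    fun f h g hf _ r h0 h1 => BohrHarmonic.E_zero_le hf h0 h1, ?_⟩
  rintro k a hk _ ha0 ha1 f h g rfl rfl rfl
  exact ⟨BohrHarmonic.inHk_omega hk ha0 ha1, BohrHarmonic.nonconstant_omega ha0 ha1,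
    fun r h0 h1 => BohrHarmonic.E_omega hk ha0 ha1 h0 h1⟩
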